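/- **Setting.** Let $X$ (problems) and $\Sigma$ (reasoning steps) be measurable spaces and $T\in\mathbb N$. A verifier is a map $h:X\times\Sigma^*\to\{\mathrm{YES},\mathrm{NO}\}$, identified with the set of pairs it accepts; put $C_h(x)=\{\tau\in\Sigma^T: h(x,\tau)=\mathrm{YES}\}$. Let $H$ be a class of verifiers. For $S\subseteq X\times\Sigma^*$ let $\mathrm{Clos}_H(S)=\bigcap_{h\in H,\,S\subseteq h}h$ (the whole domain if there is no such $h$); $H$ is *intersection-closed* if $\mathrm{Clos}_H(S)\in H$ for every finite $S\subseteq X\times\Sigma^*$. $\mathsf{VCDim}(H)$ is the supremum of the sizes of the finite sets $A\subseteq X\times\Sigma^*$ such that $\{h\cap A: h\in H\}=2^A$. **Algorithm 1** (closure algorithm). Given $S=((x^{(i)},\tau^{(i)}))_{i\le m}$ in $X\times\Sigma^T$, let $H_S$ be the set of all $h\in H$ that accept every $(x^{(i)},\tau^{(i)})$, and output the verifier $h'_S$ that accepts $(x,\tau)$ if and only if all $h\in H_S$ do. **Learning.** For $\gamma\in(0,1)$, a learner *$\gamma$-TVPAC-learns $H$ with sample size $M(\epsilon,\delta)$* if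 the following holds for all $h^*\in H$, all $\epsilon,\delta\in(0,1)$, every probability distribution $D$ on $X$, and every Markov kernel $x\mapsto\tilde D_{\mid x}$ from $X$ to $\Sigma^T$ such that, with $g(x)=C_{h^*}(x)$, $\tilde D_{\mid x}$ is supported on $g(x)$ for $D$-almost every $x$. If $m=M(\epsilon,\delta)$ pairs $(x^{(i)},\tau^{(i)})$ are drawn independently with $x^{(i)}\sim D$ and $\tau^{(i)}\sim\tilde D_{\mid x^{(i)}}$, then with probability at least $1-\delta$ the learner outputs a verifier $h$ such that $$\Pr_{x\sim D}\big[\tilde D_{\mid x}(C_h(x)\cap g(x))\ge\gamma\ \text{ and }\ C_h(x)\subseteq g(x)\big]\ge 1-\epsilon .$$ **Measurability convention.** Each $h\in H$ is measurable on $X\times\Sigma^T$, and for each $m$ the set of all $(S,(x,\tau))\in(X\times\Sigma^T)^m\times(X\times\Sigma^T)$ such that $h'_S$ accepts $(x,\tau)$ is measurable. (This is automatic if $X$ and $\Sigma$ are countable and discrete.) **Theorem.** There is an absolute constant $C>0$ such that the following holds for all $X,\Sigma,T$, all $\eta\in(0,1)$, and every intersection-closed class $H$ of verifiers with finite VC dimension.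 1. Under the measurability convention, Algorithm 1 $(1-\eta)$-TVPAC-learns $H$ with every sample size $M$ that satisfies $$M(\epsilon,\delta)\ \ge\ \frac{C}{\eta\epsilon}\Big(\mathsf{VCDim}(H)+\log\frac1\delta\Big)\qquad\text{for all }\epsilon,\delta\in(0,1);$$ in particular the bound does not depend on $T$. 2. Algorithm 1 never accepts a faulty trace: for every $h^*\in H$, every finite sample $S$ of pairs $(x^{(i)},\tau^{(i)})$ with $\tau^{(i)}\in C_{h^*}(x^{(i)})$, every $x\in X$ and every $\tau\in\Sigma^*$, if $h^*(x,\tau)=\mathrm{NO}$ then $h'_S(x,\tau)=\mathrm{NO}$. -/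

import Mathlib

open MeasureTheory ProbabilityTheory

namespace TraceVerification

universe u v

/-- A verifier on problems `X` and finite traces of reasoning steps in `σ`, identified with the set
of problem-trace pairs to which it answers YES. -/
abbrev Verifier (X : Type u) (σ : Type v) : Type (max u v) := Set (X × List σ)

/-- The traces of length exactly `T`, with the product σ-algebra if `σ` is a measurable space. -/
abbrev Trace (σ : Type v) (T : ℕ) : Type v := Fin T → σ

/-- A pair of a problem and a trace of length `T`, as a point of the domain of the verifiers. -/
def toPair {X : Type u} {σ : Type v} {T : ℕ} (p : X × Trace σ T) : X × List σ :=
  (p.1, List.ofFn p.2)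

/-- The set of traces of length `T` which the verifier `h` accepts on the problem `x`. -/
def accepted {X : Type u} {σ : Type v} (T : ℕ) (h : Verifier X σ) (x : X) : Set (Trace σ T) :=
  {τ | toPair (x, τ) ∈ h}

/-- The closure of `S` with respect to `H`: the intersection of all members of `H` that contain `S`
(the whole domain if there are none). -/
def clos {α : Type u} (H : Set (Set α)) (S : Set α) : Set α :=
  {a | ∀ h ∈ H, S ⊆ h → a ∈ h}

/-- `H` is intersection-closed: the closure of every finite set is a member of `H`. -/
def IntersectionClosed {α : Type u} (H : Set (Set α)) : Prop :=
  ∀ S : Finset α, clos H (S : Set α) ∈ H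

/-- `H` shatters `A`: every subset of `A` is cut out of `A` by a member of `H`. -/
def Shatters {α : Type u} (H : Set (Set α)) (A : Set α) : Prop :=
  ∀ B : Set α, B ⊆ A → ∃ h ∈ H, h ∩ A = B

/-- The VC dimension: the supremum of the cardinalities of the finite shattered sets. -/
noncomputable def vcDim {α : Type u} (H : Set (Set α)) : ℕ∞ :=
  ⨆ (A : Finset α) (_ : Shatters H (A : Set α)), (A.card : ℕ∞)

/-- A learner maps each finite sample of problem-trace pairs to a verifier. -/
abbrev Learner (X : Type u) (σ : Type v) (T : ℕ) : Type (max u v) :=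
  (m : ℕ) → (Fin m → X × Trace σ T) → Verifier X σ

/-- The verifiers in `H` that accept all pairs in the sample `S`. -/
def consistent {X : Type u} {σ : Type v} {T m : ℕ} (H : Set (Verifier X σ))
    (S : Fin m → X × Trace σ T) : Set (Verifier X σ) :=
  {h | h ∈ H ∧ ∀ i, toPair (S i) ∈ h}

/-- Intersection of consistent verifiers: accept a pair if and only if every verifier in `H` that
is consistent with the sample accepts it. -/
def intersectConsistent {X : Type u} {σ : Type v} (T : ℕ) (H : Set (Verifier X σ)) :
    Learner X σ T :=
  fun _ S => {p | ∀ h ∈ consistent H S, p ∈ h}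

/-- `h` is `γ`-complete on the problem `x` with respect to the correct traces `g` and the
distributions `Dt x` over correct traces. -/
def CompleteAt {X : Type u} {σ : Type v} [MeasurableSpace σ] {T : ℕ} (γ : ℝ) (h : Verifier X σ)
    (g : X → Set (Trace σ T)) (Dt : X → Measure (Trace σ T)) (x : X) : Prop :=
  ENNReal.ofReal γ ≤ Dt x (accepted T h x ∩ g x)

/-- `h` is sound on the problem `x`: it accepts no trace of length `T` outside of `g x`. -/
def SoundAt {X : Type u} {σ : Type v} {T : ℕ} (h : Verifier X σ)
    (g : X → Set (Trace σ T)) (x : X) : Prop :=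
  accepted T h x ⊆ g x

/-- The verifiers in `H` are measurable on pairs with traces of length `T`, and so is the answer of
the learner `A` as a function of the sample and of the pair to be verified. -/
structure MeasurableLearning {X : Type u} {σ : Type v} [MeasurableSpace X] [MeasurableSpace σ]
    {T : ℕ} (A : Learner X σ T) (H : Set (Verifier X σ)) : Prop where
  verifier : ∀ h ∈ H, MeasurableSet {p : X × Trace σ T | toPair p ∈ h}
  learner : ∀ m : ℕ,
    MeasurableSet {q : (Fin m → X × Trace σ T) × (X × Trace σ T) | toPair q.2 ∈ A m q.1}

/-- The learner `A` `γ`-TVPAC-learns `H` with sample size `M ε δ`: for every target `hstar ∈ H`,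
all `ε, δ ∈ (0,1)`, every distribution `D` of problems, and all distributions `Dt x` of traces that
are supported on the set `g x` of the traces accepted by `hstar`, a sample of `M ε δ` independent
pairs `(x, τ)` with `x ∼ D`, `τ ∼ Dt x` gives with probability at least `1 - δ` a verifier that is
`γ`-complete and sound on a problem drawn from `D` with probability at least `1 - ε`.
Both probabilities are bounded through the failure events; for events that are not known to be
measurable this is the stronger form. -/
def TVPACLearns {X : Type u} {σ : Type v} [MeasurableSpace X] [MeasurableSpace σ] {T : ℕ}
    (A : Learner X σ T) (γ : ℝ) (H : Set (Verifier X σ)) (M : ℝ → ℝ → ℕ) : Prop :=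
  ∀ hstar ∈ H, ∀ ε ∈ Set.Ioo (0 : ℝ) 1, ∀ δ ∈ Set.Ioo (0 : ℝ) 1,
    ∀ (D : Measure X) [IsProbabilityMeasure D]
      (Dt : Kernel X (Trace σ T)) [IsMarkovKernel Dt] (g : X → Set (Trace σ T)),
      (∀ x, g x = accepted T hstar x) →
      (∀ᵐ x ∂D, Dt x (g x)ᶜ = 0) →
      Measure.pi (fun _ : Fin (M ε δ) => D.compProd Dt)
        {S | ¬ D {x | ¬ (CompleteAt γ (A (M ε δ) S) g (fun y => Dt y) x ∧
                          SoundAt (A (M ε δ) S) g x)} ≤ ENNReal.ofReal ε}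
        ≤ ENNReal.ofReal δ

end TraceVerification

/-! The target is itself consistent with the sample, so the output lies below it: soundness is
automatic and only incompleteness can fail. By Markov's inequality it suffices that the output have
error at most `η * ε` under the joint law of problems and traces (`measure_not_completeAt_le`).

The closure is a compression scheme: at most `d` sample points span it (`exists_spanning_subset`). A
union bound over `d`-subsets of the sample would cost a factor `log (1/ε)`. Instead the sample is
cut into `2d + 1` blocks; the spanning points lie in some `d` of them (`exists_blocks`). The other
`d + 1` blocks, over half of the blocks, are independent of these `d` and lie in the closure learned
from them, which is exponentially unlikely if its error is large (`pi_consistent_le`). Only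
`(2d+1).choose d ≤ 4 ^ d` choices of blocks occur, whatever the sample size (`pi_closTrace_le`). -/

namespace TraceVerification

section Closure

universe u
variable {α : Type u} {H : Set (Set α)}

lemma subset_clos (H : Set (Set α)) (S : Set α) : S ⊆ clos H S :=
  fun _ ha _ _ hS => hS ha

lemma clos_mono {S S' : Set α} (h : S ⊆ S') : clos H S ⊆ clos H S' :=
  fun _ ha k hk hS => ha k hk (h.trans hS)

lemma clos_subset_clos {S S' : Set α} (h : S ⊆ clos H S') : clos H S ⊆ clos H S' :=
  fun _ ha k hk hS => ha k hk fun _ hb => h hb k hk hS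

/-- Every finite set has a spanning subset of cardinality at most the VC dimension. -/
lemma IntersectionClosed.exists_spanning_subset (hH : IntersectionClosed H) {d : ℕ}
    (hd : vcDim H = d) (S : Finset α) :
    ∃ K ⊆ S, K.card ≤ d ∧ clos H (K : Set α) = clos H (S : Set α) := by
  classical
  obtain ⟨K, hKS, hK⟩ := (S.powerset.filter
    fun K : Finset α => clos H (K : Set α) = clos H (S : Set α)).exists_le_minimal
      (a := S) (by simp)
  have hKm := hK.prop
  simp only [Finset.mem_filter, Finset.mem_powerset] at hKm
  refine ⟨K, hKm.1, ?_, hKm.2⟩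
  -- Minimality gives shattering: `clos H B` cuts out `B`, for a further point `a` of `K` in it
  -- would be redundant, and `K.erase a` would still span.
  have hsh : Shatters H (K : Set α) := by
    intro B hB
    have hBfin : B.Finite := K.finite_toSet.subset hB
    refine ⟨clos H B, by simpa using hH hBfin.toFinset, ?_⟩
    refine Set.Subset.antisymm ?_ fun a ha => ⟨subset_clos H B ha, hB ha⟩
    rintro a ⟨haB, haK⟩
    by_contra ha
    have hsub : B ⊆ (K.erase a : Finset α) := fun b hb => by
      simp only [Finset.coe_erase, Set.mem_sdiff, Set.mem_singleton_iff]
      exact ⟨hB hb, fun h => ha (h ▸ hb)⟩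
    have hcl : clos H (K.erase a : Finset α) = clos H (K : Set α) := by
      refine Set.Subset.antisymm (clos_mono (by simp)) (clos_subset_clos fun b hb => ?_)
      by_cases hba : b = a
      · exact clos_mono hsub (hba ▸ haB)
      · exact subset_clos H _ (by simpa using ⟨hb, hba⟩)
    have hle := hK.le_of_le
      (show K.erase a ∈ S.powerset.filter
        fun K : Finset α => clos H (K : Set α) = clos H (S : Set α) by
        simp only [Finset.mem_filter, Finset.mem_powerset]
        exact ⟨(K.erase_subset a).trans hKm.1, hcl.trans hKm.2⟩) (K.erase_subset a)
    exact Finset.notMem_erase a K (hle haK)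
  have h : (K.card : ℕ∞) ≤ vcDim H :=
    le_iSup₂ (f := fun (A : Finset α) (_ : Shatters H (A : Set α)) => (A.card : ℕ∞)) K hsh
  rw [hd] at h
  exact_mod_cast h

end Closure

/-- Each residue class mod `b` contains the indices `j + b * q` with `q < n / b`. -/
lemma card_mul_div_le_card_residues (n b : ℕ) (hb : 0 < b) (I : Finset (Fin b)) :
    I.card * (n / b) ≤
      (Finset.univ.filter fun i : Fin n => (⟨i % b, Nat.mod_lt _ hb⟩ : Fin b) ∈ I).card := by
  rw [← Fintype.card_fin (n / b), ← Finset.card_univ, ← Finset.card_product]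
  have hlt : ∀ p : Fin b × Fin (n / b), p.1 + b * p.2 < n := fun p => by
    have h1 := p.1.2
    have h2 : (p.2 : ℕ) + 1 ≤ n / b := p.2.2
    have h3 : b * (p.2 + 1) ≤ n := (Nat.mul_le_mul_left b h2).trans (Nat.mul_div_le n b)
    rw [mul_add] at h3
    omega
  refine Finset.card_le_card_of_injOn (fun p => ⟨p.1 + b * p.2, hlt p⟩) ?_ ?_
  · rintro ⟨j, q⟩ hp
    simp only [Finset.coe_product, Set.mem_prod, Finset.mem_coe] at hp
    simpa [Nat.add_mul_mod_self_left, Nat.mod_eq_of_lt j.2] using hp.1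
  · rintro ⟨j, q⟩ - ⟨j', q'⟩ - h
    simp only [Fin.mk.injEq] at h
    have hj : (j : ℕ) = j' := by
      simpa [Nat.add_mul_mod_self_left, Nat.mod_eq_of_lt j.2, Nat.mod_eq_of_lt j'.2]
        using congrArg (· % b) h
    have hq : (q : ℕ) = q' := Nat.eq_of_mul_eq_mul_left hb (by omega)
    exact Prod.ext (Fin.ext hj) (Fin.ext hq)

/-- If the set `A s` learned from the coordinates with `p` contains all other coordinates, then its
complement has measure at most `θ`, except with probability `(1 - θ) ^ r`, where `r` is the number
of the other coordinates. -/
lemma pi_consistent_le {α ι : Type*} [MeasurableSpace α] [Fintype ι] (P : Measure α)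
    [IsProbabilityMeasure P] (p : ι → Prop) [DecidablePred p]
    (A : ({i // p i} → α) → Set α)
    (hA : MeasurableSet {q : ({i // p i} → α) × α | q.2 ∈ A q.1}) (θ : ENNReal) :
    Measure.pi (fun _ : ι => P)
      {S | (∀ i, ¬ p i → S i ∈ A fun j => S j) ∧ θ < P (A fun j => S j)ᶜ}
      ≤ (1 - θ) ^ Fintype.card {i // ¬ p i} := by
  set E : Set (({i // p i} → α) × ({i // ¬ p i} → α)) :=
    {q | (∀ i, q.2 i ∈ A q.1) ∧ θ < P (A q.1)ᶜ} with hE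
  have hsec : ∀ s, MeasurableSet (A s) := fun s => measurable_prodMk_left hA
  have hmeas : MeasurableSet E := by
    have h1 : MeasurableSet {q : ({i // p i} → α) × ({i // ¬ p i} → α) |
        ∀ i, q.2 i ∈ A q.1} := by
      rw [Set.ofPred_forall]
      refine MeasurableSet.iInter fun i => ?_
      exact (show Measurable fun q : ({i // p i} → α) × ({i // ¬ p i} → α) => (q.1, q.2 i) by
        fun_prop) hA
    exact h1.inter (measurableSet_lt measurable_const
      ((measurable_measure_prodMk_left (ν := P) hA.compl).comp measurable_fst))
  have hmp := measurePreserving_piEquivPiSubtypeProd (fun _ : ι => P) p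
  have hpre : {S : ι → α | (∀ i, ¬ p i → S i ∈ A fun j => S j) ∧ θ < P (A fun j => S j)ᶜ} =
      MeasurableEquiv.piEquivPiSubtypeProd (fun _ => α) p ⁻¹' E := by
    ext S
    simp [hE, MeasurableEquiv.piEquivPiSubtypeProd, Equiv.piEquivPiSubtypeProd]
  rw [hpre, hmp.measure_preimage hmeas.nullMeasurableSet, Measure.prod_apply hmeas]
  calc _ ≤ ∫⁻ _ : {i // p i} → α, (1 - θ) ^ Fintype.card {i // ¬ p i}
        ∂(Measure.pi fun _ => P) := by
        refine lintegral_mono fun s => ?_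
        -- With the training coordinates `s` fixed, the remaining ones are independent and each
        -- falls in `A s` with probability at most `1 - θ`.
        by_cases hs : θ < P (A s)ᶜ
        · have : Prod.mk s ⁻¹' E = Set.univ.pi fun _ => A s := by
            ext t; simp [hE, hs]
          rw [this, Measure.pi_pi, Finset.prod_const, Finset.card_univ]
          gcongr
          rw [prob_compl_eq_one_sub (hsec s)] at hs
          have h1 : P (A s) ≤ 1 := prob_le_one
          rw [← ENNReal.sub_sub_cancel ENNReal.one_ne_top h1]
          exact tsub_le_tsub_left hs.le 1
        · have : Prod.mk s ⁻¹' E = ∅ := by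
            ext t; simp [hE, hs]
          rw [this]; simp
    _ = _ := by simp

/-- Uses `4 ≤ e²` and `1 - θ ≤ e^(-θ)`. The constant is `8 = 4 * 2`: `4` for the passage from `n` to
`r`, `2` for the exponent of `e²`. -/
lemma four_pow_mul_one_sub_pow_le {θ δ : ℝ} (hθ : θ ∈ Set.Ioo (0 : ℝ) 1) (hδ : 0 < δ)
    (d n r : ℕ) (hr : n ≤ 4 * r)
    (hn : 8 * (1 / θ * (d + Real.log (1 / δ))) ≤ n) (hlog : 0 ≤ Real.log (1 / δ)) :
    4 ^ d * (1 - θ) ^ r ≤ δ := by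
  have hθ0 := hθ.1
  have h4 : (4 : ℝ) ≤ Real.exp 2 := by
    have := Real.add_one_le_exp (1 : ℝ)
    rw [show (2 : ℝ) = 1 + 1 by norm_num, Real.exp_add]
    nlinarith
  have h1 : (4 : ℝ) ^ d ≤ Real.exp (d * 2) := by
    rw [Real.exp_nat_mul]; gcongr
  have h2 : (1 - θ) ^ r ≤ Real.exp (r * -θ) := by
    rw [Real.exp_nat_mul]
    exact pow_le_pow_left₀ (by linarith [hθ.2]) (Real.one_sub_le_exp_neg θ) r
  have hr' : (n : ℝ) ≤ 4 * r := by exact_mod_cast hr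
  have h3 : 2 * (d + Real.log (1 / δ)) ≤ r * θ := by
    have h := mul_le_mul_of_nonneg_right (hn.trans hr') hθ0.le
    have e : 8 * (1 / θ * (d + Real.log (1 / δ))) * θ = 8 * (d + Real.log (1 / δ)) := by
      field_simp
    linarith
  calc 4 ^ d * (1 - θ) ^ r ≤ Real.exp (d * 2) * Real.exp (r * -θ) :=
        mul_le_mul h1 h2 (pow_nonneg (by linarith [hθ.2]) r) (Real.exp_pos _).le
    _ = Real.exp (d * 2 + r * -θ) := (Real.exp_add _ _).symm
    _ ≤ Real.exp (Real.log δ) := by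
        gcongr
        rw [one_div, Real.log_inv] at h3 hlog
        linarith
    _ = δ := Real.exp_log hδ

universe u v
variable {X : Type u} {σ : Type v} {T : ℕ} {H : Set (Verifier X σ)}

lemma intersectConsistent_eq_clos (H : Set (Verifier X σ)) {m : ℕ}
    (S : Fin m → X × Trace σ T) :
    intersectConsistent T H m S = clos H (Set.range fun i => toPair (S i)) := by
  ext p
  simp only [intersectConsistent, consistent, clos, Set.mem_ofPred_eq, Set.range_subset_iff,
    and_imp]

/-- The part of the closure of a family of samples that lies in the traces of length `T`. -/
def closTrace (H : Set (Verifier X σ)) {ι : Type*} (S : ι → X × Trace σ T) :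
    Set (X × Trace σ T) :=
  {p | toPair p ∈ clos H (Set.range fun i => toPair (S i))}

lemma mem_closTrace_self (H : Set (Verifier X σ)) {ι : Type*} (S : ι → X × Trace σ T) (i : ι) :
    S i ∈ closTrace H S :=
  subset_clos H _ ⟨i, rfl⟩

lemma closTrace_subset {ι : Type*} {S : ι → X × Trace σ T} {h : Verifier X σ} (hh : h ∈ H)
    (hS : ∀ i, toPair (S i) ∈ h) {p : X × Trace σ T} (hp : p ∈ closTrace H S) :
    toPair p ∈ h :=
  hp h hh (Set.range_subset_iff.2 hS)

/-- The closure depends only on the range of the sample, so any finite index type can be replaced by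
`Fin m`. -/
lemma MeasurableLearning.measurableSet_closTrace [MeasurableSpace X] [MeasurableSpace σ]
    (hM : MeasurableLearning (intersectConsistent T H) H) (ι : Type*) [Fintype ι] :
    MeasurableSet {q : (ι → X × Trace σ T) × (X × Trace σ T) | q.2 ∈ closTrace H q.1} := by
  let e := Fintype.equivFin ι
  have h := (show Measurable fun q : (ι → X × Trace σ T) × (X × Trace σ T) =>
    ((fun i => q.1 (e.symm i) : Fin (Fintype.card ι) → X × Trace σ T), q.2) by fun_prop)
    (hM.learner (Fintype.card ι))
  convert h using 1
  ext q
  have : (Set.range fun i => toPair (q.1 (e.symm i))) = Set.range fun i => toPair (q.1 i) :=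
    e.symm.surjective.range_comp fun i => toPair (q.1 i)
  simp only [closTrace, Set.mem_preimage, Set.mem_ofPred_eq, intersectConsistent_eq_clos, this]

/-- The closure of a sample is the closure of the part of the sample in some `d` of the blocks. -/
lemma IntersectionClosed.exists_blocks (hH : IntersectionClosed H) {d : ℕ} (hd : vcDim H = d)
    {ι κ : Type*} [Fintype ι] [Fintype κ] (f : ι → κ) (hκ : d ≤ Fintype.card κ)
    (S : ι → X × Trace σ T) :
    ∃ I : Finset κ, I.card = d ∧
      closTrace H (fun j : {i // f i ∈ I} => S j) = closTrace H S := by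
  classical
  obtain ⟨K, hKS, hKd, hK⟩ := hH.exists_spanning_subset hd
    (Finset.univ.image fun i => toPair (S i))
  -- Sample points may repeat; one index is kept per spanning point.
  obtain ⟨J, -, hJinj, hJ⟩ := Finset.exists_subset_injOn_image_eq_of_surjOn
    (f := fun i => toPair (S i)) Set.univ K (by
      intro a ha
      simpa using hKS ha)
  have hcard : (J.image f).card ≤ d := by
    rw [← hJ, Finset.card_image_of_injOn hJinj] at hKd
    exact Finset.card_image_le.trans hKd
  -- Padding to exactly `d` blocks leaves exactly `d + 1` for testing.
  obtain ⟨I, hJI, -, hI⟩ := Finset.exists_subsuperset_card_eq (Finset.subset_univ (J.image f))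
    hcard (by simpa using hκ)
  refine ⟨I, hI, ?_⟩
  have hcl : clos H (Set.range fun j : {i // f i ∈ I} => toPair (S j)) =
      clos H (Set.range fun i => toPair (S i)) := by
    refine Set.Subset.antisymm (clos_mono ?_) ?_
    · rintro _ ⟨j, rfl⟩
      exact ⟨j, rfl⟩
    · rw [Finset.coe_image, Finset.coe_univ, Set.image_univ] at hK
      rw [← hK, ← hJ]
      refine clos_mono fun a ha => ?_
      obtain ⟨i, hi, rfl⟩ := Finset.mem_image.1 (Finset.mem_coe.1 ha)
      exact ⟨⟨i, hJI (Finset.mem_image_of_mem f hi)⟩, rfl⟩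
  simp only [closTrace, hcl]

/-- The closure of a sample has large error with exponentially small probability. -/
lemma pi_closTrace_le [MeasurableSpace X] [MeasurableSpace σ] (hH : IntersectionClosed H) {d : ℕ}
    (hd : vcDim H = d) (hM : MeasurableLearning (intersectConsistent T H) H)
    (P : Measure (X × Trace σ T)) [IsProbabilityMeasure P] (n : ℕ) (θ : ENNReal) :
    Measure.pi (fun _ : Fin n => P) {S | θ < P (closTrace H S)ᶜ} ≤
      4 ^ d * (1 - θ) ^ ((d + 1) * (n / (2 * d + 1))) := by
  classical
  let f : Fin n → Fin (2 * d + 1) := fun i => ⟨i % (2 * d + 1), Nat.mod_lt _ (by omega)⟩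
  let E : Finset (Fin (2 * d + 1)) → Set (Fin n → X × Trace σ T) := fun I =>
    {S | (∀ i, ¬ f i ∈ I → S i ∈ closTrace H fun j : {i // f i ∈ I} => S j) ∧
      θ < P (closTrace H fun j : {i // f i ∈ I} => S j)ᶜ}
  have hsub : {S | θ < P (closTrace H S)ᶜ} ⊆
      ⋃ I ∈ (Finset.univ : Finset (Fin (2 * d + 1))).powersetCard d, E I := by
    intro S hS
    obtain ⟨I, hI, hcl⟩ := hH.exists_blocks hd f (by simp; omega) S
    simp only [Set.mem_iUnion, Finset.mem_powersetCard]
    refine ⟨I, ⟨Finset.subset_univ I, hI⟩, ?_⟩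
    simp only [E, hcl, Set.mem_ofPred_eq]
    exact ⟨fun i _ => mem_closTrace_self H S i, hS⟩
  have hE : ∀ I ∈ (Finset.univ : Finset (Fin (2 * d + 1))).powersetCard d,
      Measure.pi (fun _ : Fin n => P) (E I) ≤ (1 - θ) ^ ((d + 1) * (n / (2 * d + 1))) := by
    intro I hI
    refine (pi_consistent_le P (fun i => f i ∈ I) (closTrace H)
      (hM.measurableSet_closTrace _) θ).trans (pow_le_pow_right_of_le_one' tsub_le_self ?_)
    have h := card_mul_div_le_card_residues n (2 * d + 1) (by omega) Iᶜ
    rw [Finset.card_compl, Fintype.card_fin, (Finset.mem_powersetCard.1 hI).2,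
      show 2 * d + 1 - d = d + 1 by omega] at h
    rw [Fintype.card_subtype]
    simpa [f] using h
  calc _ ≤ ∑ I ∈ (Finset.univ : Finset (Fin (2 * d + 1))).powersetCard d,
        Measure.pi (fun _ : Fin n => P) (E I) :=
        (measure_mono hsub).trans (measure_biUnion_finset_le _ _)
    _ ≤ ((2 * d + 1).choose d : ENNReal) * (1 - θ) ^ ((d + 1) * (n / (2 * d + 1))) := by
        refine (Finset.sum_le_card_nsmul _ _ _ hE).trans_eq ?_
        rw [Finset.card_powersetCard, Finset.card_univ, Fintype.card_fin, nsmul_eq_mul]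
    _ ≤ _ := by
        gcongr
        exact_mod_cast Nat.choose_middle_le_pow d

/-- With `q = n / (2 * d + 1) ≥ 1`, `n < (2 * d + 1) * (q + 1) ≤ 2 * (d + 1) * (2 * q)`. -/
lemma le_four_mul_blocks {n d : ℕ} (h : 2 * d + 1 ≤ n) :
    n ≤ 4 * ((d + 1) * (n / (2 * d + 1))) := by
  have h1 : 1 ≤ n / (2 * d + 1) := (Nat.one_le_div_iff (by omega)).2 h
  have h2 := Nat.div_add_mod n (2 * d + 1)
  have h3 := Nat.mod_lt n (show 0 < 2 * d + 1 by omega)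
  nlinarith

/-- A verifier below the target is incomplete with probability at most `1 / η` times its error. -/
lemma measure_not_completeAt_le [MeasurableSpace X] [MeasurableSpace σ] (D : Measure X)
    [IsProbabilityMeasure D] (Dt : Kernel X (Trace σ T)) [IsMarkovKernel Dt]
    {g : X → Set (Trace σ T)} {h : Verifier X σ} {η ε : ℝ} (hη : η ∈ Set.Ioo (0 : ℝ) 1)
    (hh : MeasurableSet {p : X × Trace σ T | toPair p ∈ h})
    (hsound : ∀ x, SoundAt h g x)
    (herr : (D.compProd Dt) {p | toPair p ∈ h}ᶜ ≤ ENNReal.ofReal (η * ε)) :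
    D {x | ¬ (CompleteAt (1 - η) h g (fun y => Dt y) x ∧ SoundAt h g x)} ≤ ENNReal.ofReal ε := by
  have hsub : {x | ¬ (CompleteAt (1 - η) h g (fun y => Dt y) x ∧ SoundAt h g x)} ⊆
      {x | ENNReal.ofReal η ≤ Dt x (Prod.mk x ⁻¹' {p | toPair p ∈ h}ᶜ)} := by
    intro x hx
    simp only [hsound x, and_true, CompleteAt, not_le, Set.mem_ofPred_eq,
      Set.inter_eq_left.2 (hsound x)] at hx
    have hacc : MeasurableSet (accepted T h x) := measurable_prodMk_left hh
    change ENNReal.ofReal η ≤ Dt x (accepted T h x)ᶜ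
    rw [prob_compl_eq_one_sub hacc]
    refine le_trans (le_of_eq ?_) (tsub_le_tsub_left hx.le 1)
    rw [← ENNReal.ofReal_one, ← ENNReal.ofReal_sub _ (by linarith [hη.2])]
    congr 1; ring
  have hmar := mul_meas_ge_le_lintegral (μ := D)
    (Kernel.measurable_kernel_prodMk_left (κ := Dt) hh.compl) (ENNReal.ofReal η)
  rw [← Measure.compProd_apply hh.compl] at hmar
  have h2 := hmar.trans herr
  rw [ENNReal.ofReal_mul hη.1.le,
    ENNReal.mul_le_mul_iff_right (by simpa using hη.1) ENNReal.ofReal_ne_top] at h2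
  exact (measure_mono hsub).trans h2

theorem intersectConsistent_tvpacLearns [MeasurableSpace X] [MeasurableSpace σ]
    (hH : IntersectionClosed H) {d : ℕ} (hd : vcDim H = d) {η : ℝ} (hη : η ∈ Set.Ioo (0 : ℝ) 1)
    (hM : MeasurableLearning (intersectConsistent T H) H) (M : ℝ → ℝ → ℕ)
    (hMb : ∀ ε ∈ Set.Ioo (0 : ℝ) 1, ∀ δ ∈ Set.Ioo (0 : ℝ) 1,
      8 * (1 / (η * ε) * ((d : ℝ) + Real.log (1 / δ))) ≤ (M ε δ : ℝ)) :
    TVPACLearns (intersectConsistent T H) (1 - η) H M := by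
  intro hstar hstarH ε hε δ hδ D _ Dt _ g hg hsupp
  set P := D.compProd Dt with hP
  set n := M ε δ with hn
  have hθ : η * ε ∈ Set.Ioo (0 : ℝ) 1 :=
    ⟨mul_pos hη.1 hε.1, by nlinarith [hη.1, hη.2, hε.1, hε.2]⟩
  have hlog : 0 < Real.log (1 / δ) :=
    Real.log_pos (by rw [one_div]; exact one_lt_inv_iff₀.2 hδ)
  have hnb := hMb ε hε δ hδ
  -- No block is empty; the strict positivity of `log (1/δ)` covers `d = 0`.
  have hnd : 2 * d + 1 ≤ n := by
    have h1 : (d : ℝ) + Real.log (1 / δ) ≤ 1 / (η * ε) * (d + Real.log (1 / δ)) := by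
      refine le_mul_of_one_le_left (by positivity) ?_
      rw [one_div]
      exact (one_le_inv₀ hθ.1).2 hθ.2.le
    have h2 : 2 * (d : ℝ) < n := by
      have : (0 : ℝ) ≤ d := by positivity
      linarith
    exact_mod_cast h2
  have hnull : ∀ᵐ p ∂P, toPair p ∈ hstar := by
    have hm := hM.verifier hstar hstarH
    rw [ae_iff, hP]
    change (D.compProd Dt) {p | toPair p ∈ hstar}ᶜ = 0
    rw [Measure.compProd_apply hm.compl, lintegral_eq_zero_iff
      (Kernel.measurable_kernel_prodMk_left hm.compl)]
    filter_upwards [hsupp] with x hx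
    rw [hg x] at hx
    exact hx
  have hcons : ∀ᵐ S ∂Measure.pi (fun _ : Fin n => P), ∀ i, toPair (S i) ∈ hstar :=
    ae_all_iff.2 fun i =>
      (Measure.quasiMeasurePreserving_eval (fun _ : Fin n => P) i).ae hnull
  have hle : Measure.pi (fun _ : Fin n => P)
      {S | ¬ D {x | ¬ (CompleteAt (1 - η) (intersectConsistent T H n S) g (fun y => Dt y) x ∧
        SoundAt (intersectConsistent T H n S) g x)} ≤ ENNReal.ofReal ε} ≤
      Measure.pi (fun _ : Fin n => P) {S | ENNReal.ofReal (η * ε) < P (closTrace H S)ᶜ} := by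
    refine measure_mono_ae ?_
    filter_upwards [hcons] with S hS hbad
    by_contra hgood
    refine hbad ?_
    have heq : closTrace H S = {p | toPair p ∈ intersectConsistent T H n S} := by
      rw [intersectConsistent_eq_clos]; rfl
    refine measure_not_completeAt_le D Dt hη (measurable_prodMk_left (hM.learner n)) ?_ ?_
    · intro x τ hτ
      rw [hg x]
      exact closTrace_subset hstarH hS (heq ▸ hτ)
    · rw [← heq]
      exact not_lt.1 hgood
  refine hle.trans ((pi_closTrace_le hH hd hM P n _).trans ?_)
  rw [← ENNReal.ofReal_one, ← ENNReal.ofReal_sub _ hθ.1.le,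
    ← ENNReal.ofReal_pow (by linarith [hθ.2]),
    show (4 : ENNReal) = ENNReal.ofReal 4 by simp, ← ENNReal.ofReal_pow (by norm_num),
    ← ENNReal.ofReal_mul (by positivity)]
  exact ENNReal.ofReal_le_ofReal
    (four_pow_mul_one_sub_pow_le hθ hδ.1 d n _ (le_four_mul_blocks hnd) hnb hlog.le)

end TraceVerification

theorem mainTheorem6 :
    ∃ C : ℝ, 0 < C ∧
      ∀ (X : Type*) (σ : Type*) [MeasurableSpace X] [MeasurableSpace σ] (T : ℕ)
        (H : Set (TraceVerification.Verifier X σ)) (d : ℕ) (η : ℝ),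
        η ∈ Set.Ioo (0 : ℝ) 1 →
        TraceVerification.IntersectionClosed H →
        TraceVerification.vcDim H = (d : ℕ∞) →
        -- `(1 - η)`-TVPAC learning with `O((d + log (1/δ)) / (η ε))` samples
        (TraceVerification.MeasurableLearning (TraceVerification.intersectConsistent T H) H →
          ∀ M : ℝ → ℝ → ℕ,
            (∀ ε ∈ Set.Ioo (0 : ℝ) 1, ∀ δ ∈ Set.Ioo (0 : ℝ) 1,
              C * (1 / (η * ε) * ((d : ℝ) + Real.log (1 / δ))) ≤ (M ε δ : ℝ)) →
            TraceVerification.TVPACLearns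
              (TraceVerification.intersectConsistent T H) (1 - η) H M) ∧
        -- a faulty trace is never accepted, whatever the sample of correct traces was
        (∀ hstar ∈ H, ∀ (m : ℕ) (S : Fin m → X × TraceVerification.Trace σ T),
          (∀ i, (S i).2 ∈ TraceVerification.accepted T hstar (S i).1) →
          ∀ (x : X) (τ : List σ), (x, τ) ∉ hstar →
            (x, τ) ∉ TraceVerification.intersectConsistent T H m S) := by

  refine ⟨8, by norm_num, ?_⟩
  intro X σ _ _ T H d η hη hH hd
  refine ⟨fun hM M hMb =>
    TraceVerification.intersectConsistent_tvpacLearns hH hd hη hM M hMb, ?_⟩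
  intro hstar hstarH m S hS x τ hτ hmem
  exact hτ (hmem hstar ⟨hstarH, hS⟩)
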